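/- Let $n \ge 2$, let $\mathbb{R}^n$ carry its standard Euclidean metric $h = \langle\cdot,\cdot\rangle$ with norm $|\cdot|$, and let $$P_n(x) = \frac{\sqrt{n(n+1)}}{6}\sum_{j=2}^{n}\frac{1}{\sqrt{j(j+1)}}\sum_{i=1}^{j-1}\left(x_j^3 - 3x_jx_i^2\right),$$ a homogeneous cubic polynomial on $\mathbb{R}^n$. For a cubic polynomial $P$ write $P_{ij}$ and $P_{ijk}$ for its partial derivatives with respect to the standard coordinates (sums over repeated indices are understood), and $|\mathrm{Hess}\,P|^2 = \sum_{i,j}P_{ij}^2$. Let $\mathcal{E}(P)$ be the set of points at which the restriction of $P$ to the unit sphere attains its maximum, and let $\mathfrak{m}(P) = \sup_{e \in \mathcal{E}(P)}\frac{|\mathrm{Hess}\,P(e)|^2}{36P(e)^2}$. Let $\mathrm{Aut}(P)$ be the group of conformal linear transformations $g$ of $\mathbb{R}^n$ (positive multiples of orthogonal transformations) with $P\circ g = P$. Then: 1. $P_n$ solves the system $\Delta P = 0$, $|\mathrm{Hess}\,P(x)|^2 = \kappa|x|^2$ with $\kappa = n(n-1)$. 2. $P_n$ is conformally associative: with $\kappa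 = n(n-1)$, $P = P_n$ and $A_{ijkl} = P_{lip}P_{jkp} - P_{ljp}P_{ikp}$, there holds $A_{ijkl} = \frac{\kappa}{n-1}\left(h_{ki}h_{jl} - h_{kj}h_{il}\right)$ for all $i,j,k,l$; and if $n \ge 3$, then the trace-free (Weyl) part of $A$, namely $$A_{ijkl} + \tfrac{1}{n-2}\left(h_{ki}R_{jl} - h_{kj}R_{il} - h_{li}R_{jk} + h_{lj}R_{ik}\right) - \tfrac{1}{(n-1)(n-2)}S\left(h_{ki}h_{jl} - h_{kj}h_{il}\right)$$ with $R_{ij} = A_{pijp}$ and $S = R_{pp}$, vanishes. 3. $\mathfrak{m}(P_n) = \frac{n}{n-1}$, and $\max_{|x| = 1}P_n(x) = \frac{n-1}{6}$. 4. $\mathcal{E}(P_n)$ has exactly $n+1$ elements; write $\mathcal{E}(P_n) = \{v_0,\dots,v_n\}$. Then $\sum_a v_a = 0$, $\langle v_a, v_b\rangle = -\frac1n$ for $a \ne b$, and $\sum_a\langle x, v_a\rangle v_a = \frac{n+1}{n}x$ for all $x \in \mathbb{R}^n$. 5. For every $v \in \mathcal{E}(P_n)$, $P_n(v)_{ij}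 = n v_iv_j - h_{ij}$. 6. $\mathrm{Aut}(P_n)$ preserves $\mathcal{E}(P_n)$, and its action on $\mathcal{E}(P_n)$ is an isomorphism of $\mathrm{Aut}(P_n)$ onto the group $S_{n+1}$ of all permutations of $\mathcal{E}(P_n)$. The group $\mathrm{Aut}(P_n)$ is generated by the orthogonal reflections through the hyperplanes perpendicular to the differences $y - z$ for distinct $y, z \in \mathcal{E}(P_n)$. 7. $P_n$ is orthogonally indecomposable: there are no nonzero orthogonal subspaces $V$, $W$ with $\mathbb{R}^n = V\oplus W$ and $P_n(a + b) = P_n(a) + P_n(b)$ for all $a \in V$, $b \in W$. 8. The critical points of the restriction of $P_n$ to the unit sphere are exactly the vectors $$v_I = \sqrt{\frac{n}{k(n+1-k)}}\sum_{a \in I}v_a,\qquad I \subset \{0,\dots,n\},\quad k = |I|,\quad 1 \le k \le n,$$ and $6P_n(v_I) = (n+1-2k)\sqrt{\frac{n}{k(n+1-k)}}$. -/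

import Mathlib

open MvPolynomial

/-- Euclidean space `ℝⁿ`. -/
abbrev Euc (n : ℕ) : Type := EuclideanSpace ℝ (Fin n)

/-- The value at `x ∈ ℝⁿ` of a real polynomial in `n` variables. -/
noncomputable def polyVal {n : ℕ} (P : MvPolynomial (Fin n) ℝ) (x : Euc n) : ℝ :=
  eval (fun i => x i) P

/-- The simplicial polynomial
`P_n = (√(n(n+1))/6) ∑_{j=2}^{n} (1/√(j(j+1))) ∑_{i=1}^{j-1} (x_j³ - 3 x_j x_i²)`.
The variables are indexed by `Fin n`, that is from `0`, so the `1`-based index of the variable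
`X j` is `j + 1`, and the term of `j = 0` is an empty sum. -/
noncomputable def simplicialPoly (n : ℕ) : MvPolynomial (Fin n) ℝ :=
  C (Real.sqrt ((n : ℝ) * ((n : ℝ) + 1)) / 6) *
    ∑ j : Fin n, C (1 / Real.sqrt (((j : ℕ) + 1 : ℝ) * ((j : ℕ) + 2 : ℝ))) *
      ∑ i ∈ Finset.Iio j, (X j ^ 3 - 3 * X j * X i ^ 2)

/-- The Laplacian `∑ i, ∂²P/∂x_i²`. -/
noncomputable def polyLaplacian {n : ℕ} (P : MvPolynomial (Fin n) ℝ) : MvPolynomial (Fin n) ℝ :=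
  ∑ i, pderiv i (pderiv i P)

/-- The component `P(x)_{ij}` of the Hessian of `P` at `x`. -/
noncomputable def polyHess {n : ℕ} (P : MvPolynomial (Fin n) ℝ) (x : Euc n) (i j : Fin n) : ℝ :=
  polyVal (pderiv i (pderiv j P)) x

/-- The squared norm (complete contraction) `|Hess P(x)|²` of the Hessian of `P` at `x`. -/
noncomputable def hessNormSq {n : ℕ} (P : MvPolynomial (Fin n) ℝ) (x : Euc n) : ℝ :=
  ∑ i, ∑ j, polyHess P x i j ^ 2

/-- `P` solves the system `Δ P = 0`, `|Hess P|² = κ |x|²`. -/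
def SolvesEinstein {n : ℕ} (P : MvPolynomial (Fin n) ℝ) (κ : ℝ) : Prop :=
  polyLaplacian P = 0 ∧ ∀ x : Euc n, hessNormSq P x = κ * ‖x‖ ^ 2

/-- The third partial derivative `P_{ijk}`. -/
noncomputable def polyThird {n : ℕ} (P : MvPolynomial (Fin n) ℝ) (i j k : Fin n) :
    MvPolynomial (Fin n) ℝ :=
  pderiv i (pderiv j (pderiv k P))

/-- The components of the Euclidean metric. -/
noncomputable def euclMetric {n : ℕ} (i j : Fin n) : MvPolynomial (Fin n) ℝ :=
  if i = j then 1 else 0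

/-- The nonassociativity tensor `2 P_{l[i}^p P_{j]kp} = P_{li}^p P_{jkp} - P_{lj}^p P_{ikp}`. -/
noncomputable def nonassocTensor {n : ℕ} (P : MvPolynomial (Fin n) ℝ) (i j k l : Fin n) :
    MvPolynomial (Fin n) ℝ :=
  ∑ p, (polyThird P l i p * polyThird P j k p - polyThird P l j p * polyThird P i k p)

/-- The trace `A_{pij}^p` of the nonassociativity tensor `A` of `P`. -/
noncomputable def nonassocRic {n : ℕ} (P : MvPolynomial (Fin n) ℝ) (i j : Fin n) :
    MvPolynomial (Fin n) ℝ :=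
  ∑ p, nonassocTensor P p i j p

/-- The complete trace of the nonassociativity tensor of `P`. -/
noncomputable def nonassocScal {n : ℕ} (P : MvPolynomial (Fin n) ℝ) : MvPolynomial (Fin n) ℝ :=
  ∑ p, nonassocRic P p p

/-- The conformal nonassociativity tensor (the trace-free part of the nonassociativity tensor, with
the same coefficients as for the Weyl tensor). It is meaningful for `3 ≤ n`. -/
noncomputable def confNonassocTensor {n : ℕ} (P : MvPolynomial (Fin n) ℝ) (i j k l : Fin n) :
    MvPolynomial (Fin n) ℝ :=
  nonassocTensor P i j k l
    + C (1 / ((n : ℝ) - 2)) *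
      ((euclMetric k i * nonassocRic P j l - euclMetric k j * nonassocRic P i l)
        - (euclMetric l i * nonassocRic P j k - euclMetric l j * nonassocRic P i k))
    - C (1 / (((n : ℝ) - 1) * ((n : ℝ) - 2))) * nonassocScal P *
      (euclMetric k i * euclMetric j l - euclMetric k j * euclMetric i l)

/-- Conformal associativity of a solution `P` of the system with constant `κ` in dimension `2 ≤ n`:
`2 P_{l[i}^p P_{j]kp} = (2κ/(n-1)) h_{k[i} h_{j]l}`. -/
def IsConfAssocSolution {n : ℕ} (P : MvPolynomial (Fin n) ℝ) (κ : ℝ) : Prop :=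
  SolvesEinstein P κ ∧ ∀ i j k l : Fin n, nonassocTensor P i j k l =
    C (κ / ((n : ℝ) - 1)) *
      (euclMetric k i * euclMetric j l - euclMetric k j * euclMetric i l)

/-- The set of points at which `P` attains its maximum on the unit sphere. -/
def sphereMaxima {n : ℕ} (P : MvPolynomial (Fin n) ℝ) : Set (Euc n) :=
  {x | x ∈ Metric.sphere (0 : Euc n) 1 ∧ IsMaxOn (polyVal P) (Metric.sphere (0 : Euc n) 1) x}

/-- The invariant `𝓂(P) = sup |Hess P(e)|² / (36 P(e)²)`, over the maxima `e` of `P` on the unit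
sphere. -/
noncomputable def mInvariant {n : ℕ} (P : MvPolynomial (Fin n) ℝ) : ℝ :=
  ⨆ e : sphereMaxima P, hessNormSq P (e : Euc n) / (36 * polyVal P (e : Euc n) ^ 2)

/-- `v` is a critical point of the restriction of `P` to the unit sphere: `v` is on the sphere and
`dP(v)` vanishes on the tangent space `v^⊥` of the sphere at `v`. -/
def IsSphereCritical {n : ℕ} (P : MvPolynomial (Fin n) ℝ) (v : Euc n) : Prop :=
  v ∈ Metric.sphere (0 : Euc n) 1 ∧
    ∀ w : Euc n, inner ℝ v w = 0 → ∑ i, polyVal (pderiv i P) v * w i = 0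

/-- `P` is orthogonally decomposable: there is a splitting of `ℝⁿ` into two nonzero orthogonal
subspaces `A` and `B` such that `P (a + b) = P a + P b` for `a ∈ A` and `b ∈ B`. -/
def OrthDecomposable {n : ℕ} (P : MvPolynomial (Fin n) ℝ) : Prop :=
  ∃ A B : Submodule ℝ (Euc n), A ≠ ⊥ ∧ B ≠ ⊥ ∧ A ⟂ B ∧ IsCompl A B ∧
    ∀ a ∈ A, ∀ b ∈ B, polyVal P (a + b) = polyVal P a + polyVal P b

/-- The automorphism group of `P`: the conformal linear transformations `g` of `ℝⁿ` (positive
multiples of orthogonal transformations) that leave `P` invariant. -/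
def polyAut {n : ℕ} (P : MvPolynomial (Fin n) ℝ) : Subgroup (Euc n ≃ₗ[ℝ] Euc n) where
  carrier := {g | (∃ c : ℝ, 0 < c ∧ ∀ x, ‖g x‖ = c * ‖x‖) ∧ ∀ x, polyVal P (g x) = polyVal P x}
  mul_mem' := by
    rintro a b ⟨⟨c, hc, ha⟩, hP⟩ ⟨⟨d, hd, hb⟩, hQ⟩
    refine ⟨⟨c * d, mul_pos hc hd, fun x => ?_⟩, fun x => ?_⟩
    · rw [LinearEquiv.mul_apply, ha, hb, mul_assoc]
    · rw [LinearEquiv.mul_apply, hP, hQ]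
  one_mem' := ⟨⟨1, one_pos, fun x => by simp⟩, fun x => by simp⟩
  inv_mem' := by
    rintro a ⟨⟨c, hc, ha⟩, hP⟩
    have key : ∀ x, a (a⁻¹ x) = x := fun x => a.apply_symm_apply x
    refine ⟨⟨c⁻¹, inv_pos.mpr hc, fun x => ?_⟩, fun x => ?_⟩
    · have h := ha (a⁻¹ x)
      rw [key] at h
      rw [h, inv_mul_cancel_left₀ hc.ne']
    · rw [← hP (a⁻¹ x), key]

/-- The orthogonal reflection of `ℝⁿ` through the hyperplane perpendicular to `r`. -/
noncomputable def hyperplaneReflection {n : ℕ} (r : Euc n) : Euc n ≃ₗ[ℝ] Euc n :=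
  (Submodule.reflection (ℝ ∙ r)ᗮ).toLinearEquiv

/-! The nested sum defining `simplicialPoly` is a sum of cubes in disguise: up to a constant it is
the sum of `⟨x, v a⟩ ^ 3` over the `n + 1` vertices of a regular simplex, whose coordinates are the
columns of a Helmert matrix (`simplicialPoly_eq_simplexCubic`). From there on only the relations of
`IsRegularSimplex` matter: the Gram matrix, the vanishing sum and the tight frame identity.

Since the Gram matrix is a combination of the identity and the all-ones matrix, contractions of
derivatives of the cubic collapse to traces (`hessNormSq_simplexCubic`,
`nonassocTensor_simplexCubic`). The maxima come from a nonnegative cubic in `t = ⟨x, v a⟩` that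
vanishes exactly at the values taken at vertices (`polyVal_eq_sub`). Criticality says that all the
numbers `⟨w, v a⟩` satisfy one common quadratic equation, so that they take two values, and a level
set of these gives the index set `I`.

An automorphism is an isometry that permutes the maxima and is determined by that permutation;
reflections in differences of vertices realize the transpositions, which generate the symmetric
group. An orthogonal splitting would put each vertex in one of the two summands, although no two
vertices are orthogonal. -/

/-- The coordinates, up to a common factor, of the vertices of a regular simplex: for fixed `j`
the sequence is `-1, …, -1, j + 1, 0, 0, …` up to a normalization. -/
noncomputable def helmert (j a : ℕ) : ℝ :=
  (if a ≤ j then -1 else if a = j + 1 then (j : ℝ) + 1 else 0) /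
    Real.sqrt (((j : ℝ) + 1) * ((j : ℝ) + 2))

/-! ### Power sums of the columns of the Helmert matrix. -/

lemma helmert_of_le {j a : ℕ} (h : a ≤ j) :
    helmert j a = -(1 / Real.sqrt (((j : ℝ) + 1) * ((j : ℝ) + 2))) := by
  rw [helmert, if_pos h, neg_div]

lemma helmert_succ (j : ℕ) :
    helmert j (j + 1) = ((j : ℝ) + 1) * (1 / Real.sqrt (((j : ℝ) + 1) * ((j : ℝ) + 2))) := by
  rw [helmert, if_neg (by omega), if_pos rfl, mul_one_div]

lemma helmert_of_lt {j a : ℕ} (h : j + 1 < a) : helmert j a = 0 := by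
  rw [helmert, if_neg (by omega), if_neg (by omega), zero_div]

lemma sq_one_div_sqrt_mul (j : ℕ) :
    (1 / Real.sqrt (((j : ℝ) + 1) * ((j : ℝ) + 2))) ^ 2 * (((j : ℝ) + 1) * ((j : ℝ) + 2)) = 1 := by
  rw [div_pow, Real.sq_sqrt (by positivity)]
  field_simp

lemma sum_helmert_mul_of_le (n a b : ℕ) (ha : a ≤ n) (hb : b ≤ n) :
    ∑ j ∈ Finset.range n, helmert j a * helmert j b =
      (if a = b then 1 else 0) - 1 / ((n : ℝ) + 1) := by
  induction n with
  | zero =>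
    obtain rfl : a = 0 := by omega
    obtain rfl : b = 0 := by omega
    simp
  | succ n ih =>
    have hq := sq_one_div_sqrt_mul n
    have hz : ∀ c, ∑ j ∈ Finset.range n, helmert j (n + 1) * helmert j c = 0 := fun c =>
      Finset.sum_eq_zero fun j hj => by
        rw [helmert_of_lt (by have := Finset.mem_range.1 hj; omega), zero_mul]
    have hz' : ∀ c, ∑ j ∈ Finset.range n, helmert j c * helmert j (n + 1) = 0 := fun c => by
      simp_rw [mul_comm (helmert _ c)]; exact hz c
    have hq2 : (1 / Real.sqrt (((n : ℝ) + 1) * ((n : ℝ) + 2))) ^ 2 =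
        1 / (((n : ℝ) + 1) * ((n : ℝ) + 2)) := by
      rw [div_pow, Real.sq_sqrt (by positivity), one_pow]
    rw [Finset.sum_range_succ]
    set q := 1 / Real.sqrt (((n : ℝ) + 1) * ((n : ℝ) + 2)) with hqdef
    push_cast
    -- The cases say whether `a` and `b` are the new column `n + 1`, which vanishes in all earlier
    -- rows.
    rcases Nat.lt_or_ge n a with h | h <;> rcases Nat.lt_or_ge n b with h' | h'
    · obtain rfl : a = n + 1 := by omega
      obtain rfl : b = n + 1 := by omega
      rw [hz, helmert_succ, ← hqdef, if_pos rfl,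
        show 0 + ((n : ℝ) + 1) * q * (((n : ℝ) + 1) * q) = ((n : ℝ) + 1) ^ 2 * q ^ 2 by ring, hq2]
      field_simp
      ring
    · obtain rfl : a = n + 1 := by omega
      rw [hz, helmert_succ, helmert_of_le h', ← hqdef, if_neg (by omega),
        show 0 + ((n : ℝ) + 1) * q * -q = -((n : ℝ) + 1) * q ^ 2 by ring, hq2]
      field_simp
      ring
    · obtain rfl : b = n + 1 := by omega
      rw [hz', helmert_succ, helmert_of_le h, ← hqdef, if_neg (by omega),
        show 0 + -q * (((n : ℝ) + 1) * q) = -((n : ℝ) + 1) * q ^ 2 by ring, hq2]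
      field_simp
      ring
    · rw [ih h h', helmert_of_le h, helmert_of_le h', ← hqdef, neg_mul_neg, ← sq, hq2]
      field_simp
      ring

/-- The inductive step for the power sums: one more variable shifts all old linear forms by the same
multiple of `x n`, and the one new form depends on `x n` alone. -/
lemma sum_mul_helmert_succ_of_le (x : ℕ → ℝ) {n a : ℕ} (h : a ≤ n) :
    ∑ j ∈ Finset.range (n + 1), x j * helmert j a = ∑ j ∈ Finset.range n, x j * helmert j a -
      1 / Real.sqrt (((n : ℝ) + 1) * ((n : ℝ) + 2)) * x n := by
  rw [Finset.sum_range_succ, helmert_of_le h]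
  ring

lemma sum_mul_helmert_succ_self (x : ℕ → ℝ) (n : ℕ) :
    ∑ j ∈ Finset.range (n + 1), x j * helmert j (n + 1) =
      ((n : ℝ) + 1) * (1 / Real.sqrt (((n : ℝ) + 1) * ((n : ℝ) + 2)) * x n) := by
  rw [Finset.sum_range_succ, helmert_succ, Finset.sum_eq_zero, zero_add]
  · ring
  · intro j hj
    rw [helmert_of_lt (by have := Finset.mem_range.1 hj; omega), mul_zero]

lemma sum_sum_mul_helmert (x : ℕ → ℝ) (n : ℕ) :
    ∑ a ∈ Finset.range (n + 1), ∑ j ∈ Finset.range n, x j * helmert j a = 0 := by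
  induction n with
  | zero => simp
  | succ n ih =>
    rw [Finset.sum_range_succ, sum_mul_helmert_succ_self, Finset.sum_congr rfl fun a ha =>
      sum_mul_helmert_succ_of_le x (Nat.lt_succ_iff.1 (Finset.mem_range.1 ha)),
      Finset.sum_sub_distrib, ih]
    simp

lemma sum_sum_mul_helmert_sq (x : ℕ → ℝ) (n : ℕ) :
    ∑ a ∈ Finset.range (n + 1), (∑ j ∈ Finset.range n, x j * helmert j a) ^ 2 =
      ∑ j ∈ Finset.range n, x j ^ 2 := by
  induction n with
  | zero => simp
  | succ n ih =>
    have h1 := sum_sum_mul_helmert x n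
    have hq := sq_one_div_sqrt_mul n
    rw [Finset.sum_range_succ, sum_mul_helmert_succ_self, Finset.sum_congr rfl fun a ha => by
      rw [sum_mul_helmert_succ_of_le x (Nat.lt_succ_iff.1 (Finset.mem_range.1 ha)), sub_sq],
      Finset.sum_add_distrib, Finset.sum_sub_distrib, ih, ← Finset.sum_mul, ← Finset.mul_sum, h1,
      Finset.sum_range_succ (fun j => x j ^ 2)]
    simp only [Finset.sum_const, Finset.card_range, nsmul_eq_mul]
    push_cast
    linear_combination x n ^ 2 * hq

lemma sum_sum_mul_helmert_cube (x : ℕ → ℝ) (n : ℕ) :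
    ∑ a ∈ Finset.range (n + 1), (∑ j ∈ Finset.range n, x j * helmert j a) ^ 3 =
      ∑ j ∈ Finset.range n, 1 / Real.sqrt (((j : ℝ) + 1) * ((j : ℝ) + 2)) *
        ∑ i ∈ Finset.range j, (x j ^ 3 - 3 * x j * x i ^ 2) := by
  induction n with
  | zero => simp
  | succ n ih =>
    have h1 := sum_sum_mul_helmert x n
    have h2 := sum_sum_mul_helmert_sq x n
    have hq := sq_one_div_sqrt_mul n
    rw [Finset.sum_range_succ, sum_mul_helmert_succ_self, Finset.sum_congr rfl fun a ha => by
      rw [sum_mul_helmert_succ_of_le x (Nat.lt_succ_iff.1 (Finset.mem_range.1 ha))],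
      Finset.sum_range_succ (fun j => 1 / Real.sqrt (((j : ℝ) + 1) * ((j : ℝ) + 2)) * _), ← ih]
    set q := 1 / Real.sqrt (((n : ℝ) + 1) * ((n : ℝ) + 2))
    have h3 : ∀ a, (∑ j ∈ Finset.range n, x j * helmert j a - q * x n) ^ 3 =
        (∑ j ∈ Finset.range n, x j * helmert j a) ^ 3
        - 3 * (q * x n) * (∑ j ∈ Finset.range n, x j * helmert j a) ^ 2
        + 3 * (q * x n) ^ 2 * (∑ j ∈ Finset.range n, x j * helmert j a) - (q * x n) ^ 3 := by
      intro a; ring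
    simp only [h3, Finset.sum_add_distrib, Finset.sum_sub_distrib, ← Finset.mul_sum, h1, h2]
    simp only [Finset.sum_const, Finset.card_range, nsmul_eq_mul]
    push_cast
    -- The coefficient of `x n ^ 3` is `((n+1)^3 - (n+1)) q^3 = n (n+1)(n+2) q^3`, which equals `n
    -- q`.
    linear_combination n * q * x n ^ 3 * hq

/-! ### Regular simplices and the cubic as a sum of cubes. -/

/-- The vertices of a regular simplex inscribed in the unit sphere of `ℝⁿ`. -/
noncomputable def simplexVertex (n : ℕ) (a : Fin (n + 1)) : Euc n :=
  WithLp.toLp 2 fun j => Real.sqrt (((n : ℝ) + 1) / n) * helmert j a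

/-- `v` is the family of vertices of a regular simplex inscribed in the unit sphere of `ℝⁿ`. -/
structure IsRegularSimplex {n : ℕ} (v : Fin (n + 1) → Euc n) : Prop where
  inner_eq : ∀ a b, inner ℝ (v a) (v b) = if a = b then 1 else -1 / (n : ℝ)
  sum_inner : ∀ x : Euc n, ∑ a, inner ℝ x (v a) = 0
  sum_inner_sq : ∀ x : Euc n, ∑ a, inner ℝ x (v a) ^ 2 = (((n : ℝ) + 1) / n) * ‖x‖ ^ 2

/-- The Helmert sums are handled by induction on the number of variables, which needs sequences on
`ℕ`; the values beyond `n` play no role. -/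
lemma exists_nat_extension {n : ℕ} (x : Fin n → ℝ) : ∃ y : ℕ → ℝ, ∀ i : Fin n, y i = x i :=
  ⟨fun j => if h : j < n then x ⟨j, h⟩ else 0, fun i => by simp⟩

lemma inner_simplexVertex {n : ℕ} (x : Euc n) (y : ℕ → ℝ) (hy : ∀ i : Fin n, y i = x i)
    (a : Fin (n + 1)) : inner ℝ x (simplexVertex n a) =
      Real.sqrt (((n : ℝ) + 1) / n) * ∑ j ∈ Finset.range n, y j * helmert j a := by
  rw [← Fin.sum_univ_eq_sum_range (fun j => y j * helmert j a), Finset.mul_sum, PiLp.inner_apply]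
  refine Finset.sum_congr rfl fun j _ => ?_
  simp [simplexVertex, hy]
  ring

lemma isRegularSimplex_simplexVertex {n : ℕ} (hn : n ≠ 0) :
    IsRegularSimplex (simplexVertex n) where
  inner_eq a b := by
    have hs : Real.sqrt (((n : ℝ) + 1) / n) ^ 2 = ((n : ℝ) + 1) / n := Real.sq_sqrt (by positivity)
    have hn' : (n : ℝ) ≠ 0 := by exact_mod_cast hn
    rw [inner_simplexVertex _ (fun j => Real.sqrt (((n : ℝ) + 1) / n) * helmert j a)
      (fun i => rfl)]
    simp_rw [mul_assoc]
    rw [← Finset.mul_sum, sum_helmert_mul_of_le n a b (by omega) (by omega), ← mul_assoc, ← sq, hs]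
    simp only [Fin.val_inj]
    split_ifs
    · field_simp
      ring
    · field_simp
      ring
  sum_inner x := by
    obtain ⟨y, hy⟩ := exists_nat_extension x
    simp_rw [inner_simplexVertex x y hy]
    rw [← Finset.mul_sum,
      Fin.sum_univ_eq_sum_range (fun a => ∑ j ∈ Finset.range n, y j * helmert j a) (n + 1),
      sum_sum_mul_helmert, mul_zero]
  sum_inner_sq x := by
    obtain ⟨y, hy⟩ := exists_nat_extension x
    simp_rw [inner_simplexVertex x y hy, mul_pow]
    rw [← Finset.mul_sum,
      Fin.sum_univ_eq_sum_range (fun a => (∑ j ∈ Finset.range n, y j * helmert j a) ^ 2) (n + 1),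
      sum_sum_mul_helmert_sq, Real.sq_sqrt (by positivity), EuclideanSpace.norm_sq_eq,
      ← Fin.sum_univ_eq_sum_range (fun j => y j ^ 2)]
    simp [hy]

/-- The sum of the cubes of the linear forms `⟨·, v a⟩`, normalized. -/
noncomputable def simplexCubic {n : ℕ} (v : Fin (n + 1) → Euc n) : MvPolynomial (Fin n) ℝ :=
  C ((n : ℝ) ^ 2 / (6 * ((n : ℝ) + 1))) * ∑ a, (∑ i, C (v a i) * X i) ^ 3

lemma eval_linearForm {n : ℕ} (u x : Euc n) :
    eval (fun i => x i) (∑ i, C (u i) * X i) = inner ℝ x u := by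
  simp [PiLp.inner_apply]

lemma polyVal_simplexCubic {n : ℕ} (v : Fin (n + 1) → Euc n) (x : Euc n) :
    polyVal (simplexCubic v) x =
      (n : ℝ) ^ 2 / (6 * ((n : ℝ) + 1)) * ∑ a, inner ℝ x (v a) ^ 3 := by
  rw [polyVal, simplexCubic, map_mul, eval_C, map_sum]
  simp_rw [map_pow, eval_linearForm]

lemma simplicialPoly_eq_simplexCubic {n : ℕ} (hn : n ≠ 0) :
    simplicialPoly n = simplexCubic (simplexVertex n) := by
  refine MvPolynomial.funext fun x => ?_
  obtain ⟨y, hy⟩ := exists_nat_extension x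
  have h := polyVal_simplexCubic (simplexVertex n) (WithLp.toLp 2 x)
  simp only [polyVal] at h
  rw [h]
  simp_rw [inner_simplexVertex (WithLp.toLp 2 x) y hy, mul_pow]
  rw [← Finset.mul_sum,
    Fin.sum_univ_eq_sum_range (fun a => (∑ j ∈ Finset.range n, y j * helmert j a) ^ 3) (n + 1),
    sum_sum_mul_helmert_cube, ← Fin.sum_univ_eq_sum_range
      (fun j => 1 / Real.sqrt (((j : ℝ) + 1) * ((j : ℝ) + 2)) *
        ∑ i ∈ Finset.range j, (y j ^ 3 - 3 * y j * y i ^ 2)), ← mul_assoc]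
  have hI : ∀ j : Fin n, ∑ i ∈ Finset.range j, (y j ^ 3 - 3 * y j * y i ^ 2) =
      ∑ i ∈ Finset.Iio j, (x j ^ 3 - 3 * x j * x i ^ 2) := fun j => by
    rw [← Nat.Iio_eq_range, ← Fin.map_valEmbedding_Iio, Finset.sum_map]
    simp [hy]
  -- The normalization of `simplexCubic` times the cube of the scaling of the vertices is the
  -- constant in `simplicialPoly`.
  have hc : (n : ℝ) ^ 2 / (6 * ((n : ℝ) + 1)) * Real.sqrt (((n : ℝ) + 1) / n) ^ 3 =
      Real.sqrt ((n : ℝ) * ((n : ℝ) + 1)) / 6 := by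
    have hn' : (0 : ℝ) < n := by positivity
    rw [pow_succ (Real.sqrt _), Real.sq_sqrt (by positivity),
      show (n : ℝ) * ((n : ℝ) + 1) = (n : ℝ) ^ 2 * (((n : ℝ) + 1) / n) by field_simp,
      Real.sqrt_mul (by positivity), Real.sqrt_sq hn'.le]
    field_simp
  rw [hc]
  simp [simplicialPoly, hI]

/-! ### Linear algebra of the vertices. -/

namespace IsRegularSimplex

variable {n : ℕ} {v : Fin (n + 1) → Euc n}

lemma sum_inner_mul_inner (hv : IsRegularSimplex v) (x y : Euc n) :
    ∑ a, inner ℝ x (v a) * inner ℝ y (v a) = (((n : ℝ) + 1) / n) * inner ℝ x y := by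
  have h := hv.sum_inner_sq (x + y)
  have hx := hv.sum_inner_sq x
  have hy := hv.sum_inner_sq y
  simp_rw [inner_add_left, add_sq, Finset.sum_add_distrib, mul_assoc, ← Finset.mul_sum] at h
  rw [hx, hy, norm_add_sq_real] at h
  linear_combination h / 2

lemma sum_eq_zero (hv : IsRegularSimplex v) : ∑ a, v a = 0 :=
  ext_inner_left ℝ fun x => by rw [inner_sum, hv.sum_inner, inner_zero_right]

lemma sum_inner_smul (hv : IsRegularSimplex v) (x : Euc n) :
    ∑ a, inner ℝ x (v a) • v a = (((n : ℝ) + 1) / n) • x :=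
  ext_inner_left ℝ fun y => by
    simp_rw [inner_sum, inner_smul_right, hv.sum_inner_mul_inner, real_inner_comm x y]

lemma inner_self (hv : IsRegularSimplex v) (a : Fin (n + 1)) : inner ℝ (v a) (v a) = 1 := by
  rw [hv.inner_eq, if_pos rfl]

lemma norm_eq_one (hv : IsRegularSimplex v) (a : Fin (n + 1)) : ‖v a‖ = 1 := by
  have h := hv.inner_self a
  rw [real_inner_self_eq_norm_sq] at h
  exact (pow_eq_one_iff_of_nonneg (norm_nonneg _) two_ne_zero).1 h

lemma injective (hv : IsRegularSimplex v) : Function.Injective v := fun a b h => by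
  by_contra hab
  have h1 := hv.inner_eq a b
  rw [← h, hv.inner_self, if_neg hab] at h1
  have : -1 / (n : ℝ) ≤ 0 := div_nonpos_of_nonpos_of_nonneg (by norm_num) (by positivity)
  linarith

lemma sum_apply_mul_apply (hv : IsRegularSimplex v) (i j : Fin n) :
    ∑ a, v a i * v a j = (((n : ℝ) + 1) / n) * if i = j then 1 else 0 := by
  have h := hv.sum_inner_mul_inner (EuclideanSpace.single i 1) (EuclideanSpace.single j 1)
  simpa [EuclideanSpace.inner_single_left, Pi.single_apply, eq_comm] using h

lemma sum_apply (hv : IsRegularSimplex v) (i : Fin n) : ∑ a, v a i = 0 := by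
  have h := hv.sum_inner (EuclideanSpace.single i 1)
  simpa [EuclideanSpace.inner_single_left] using h

lemma sum_apply_mul (hv : IsRegularSimplex v) (a b : Fin (n + 1)) :
    ∑ i, v a i * v b i = if a = b then 1 else -1 / (n : ℝ) := by
  rw [← hv.inner_eq a b, PiLp.inner_apply]
  simp [mul_comm]

/-- The Gram matrix is `(n+1)/n` times the identity minus `1/n` times the all-ones matrix. Thus
pairing with the vertices recovers the weights `c` up to a constant, the device behind most
contractions below. -/
lemma sum_mul_inner_eq (hv : IsRegularSimplex v) (hn : n ≠ 0) (c : Fin (n + 1) → ℝ)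
    (b : Fin (n + 1)) :
    ∑ a, c a * inner ℝ (v a) (v b) = (((n : ℝ) + 1) / n) * c b - (∑ a, c a) / n := by
  have hn' : (n : ℝ) ≠ 0 := by exact_mod_cast hn
  have h : ∀ a, c a * inner ℝ (v a) (v b) =
      (((n : ℝ) + 1) / n) * (if a = b then c a else 0) - c a / n := fun a => by
    rw [hv.inner_eq]
    split_ifs
    · field_simp
      ring
    · field_simp
      ring
  simp_rw [h, Finset.sum_sub_distrib, ← Finset.mul_sum, ← Finset.sum_div]
  simp

lemma sum_mul_inner_eq' (hv : IsRegularSimplex v) (hn : n ≠ 0) (c : Fin (n + 1) → ℝ)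
    (b : Fin (n + 1)) :
    ∑ a, c a * inner ℝ (v b) (v a) = (((n : ℝ) + 1) / n) * c b - (∑ a, c a) / n := by
  rw [← hv.sum_mul_inner_eq hn]
  exact Finset.sum_congr rfl fun a _ => by rw [real_inner_comm]

lemma inner_sum_smul (hv : IsRegularSimplex v) (hn : n ≠ 0) (c : Fin (n + 1) → ℝ)
    (b : Fin (n + 1)) :
    inner ℝ (∑ a, c a • v a) (v b) = (((n : ℝ) + 1) / n) * c b - (∑ a, c a) / n := by
  rw [_root_.sum_inner, ← hv.sum_mul_inner_eq hn]
  simp_rw [real_inner_smul_left]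

end IsRegularSimplex

/-! ### Derivatives of the cubic. -/

lemma pderiv_linearForm {n : ℕ} (u : Euc n) (i : Fin n) :
    pderiv i (∑ j, C (u j) * X j : MvPolynomial (Fin n) ℝ) = C (u i) := by
  rw [map_sum, Finset.sum_eq_single i]
  · simp
  · intro j _ hj
    simp [pderiv_X_of_ne hj]
  · simp

lemma pderiv_simplexCubic {n : ℕ} (v : Fin (n + 1) → Euc n) (i : Fin n) :
    pderiv i (simplexCubic v) = C ((n : ℝ) ^ 2 / (2 * ((n : ℝ) + 1))) *
      ∑ a, C (v a i) * (∑ j, C (v a j) * X j) ^ 2 := by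
  rw [simplexCubic, pderiv_C_mul, map_sum]
  simp_rw [pderiv_pow, pderiv_linearForm]
  rw [show (n : ℝ) ^ 2 / (2 * ((n : ℝ) + 1)) =
    (n : ℝ) ^ 2 / (6 * ((n : ℝ) + 1)) * 3 by field_simp; ring, C_mul, mul_assoc]
  congr 1
  rw [Finset.mul_sum]
  refine Finset.sum_congr rfl fun a _ => ?_
  simp only [map_ofNat]
  push_cast
  ring

lemma pderiv_pderiv_simplexCubic {n : ℕ} (v : Fin (n + 1) → Euc n) (i j : Fin n) :
    pderiv i (pderiv j (simplexCubic v)) = C ((n : ℝ) ^ 2 / ((n : ℝ) + 1)) *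
      ∑ a, C (v a i * v a j) * ∑ k, C (v a k) * X k := by
  rw [pderiv_simplexCubic, pderiv_C_mul, map_sum]
  simp_rw [pderiv_C_mul, pderiv_pow, pderiv_linearForm]
  rw [show (n : ℝ) ^ 2 / ((n : ℝ) + 1) =
    (n : ℝ) ^ 2 / (2 * ((n : ℝ) + 1)) * 2 by field_simp, C_mul, mul_assoc]
  congr 1
  rw [Finset.mul_sum]
  refine Finset.sum_congr rfl fun a _ => ?_
  simp only [map_ofNat, C_mul]
  push_cast
  ring

lemma polyThird_simplexCubic {n : ℕ} (v : Fin (n + 1) → Euc n) (i j k : Fin n) :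
    polyThird (simplexCubic v) i j k =
      C ((n : ℝ) ^ 2 / ((n : ℝ) + 1) * ∑ a, v a i * v a j * v a k) := by
  rw [polyThird, pderiv_pderiv_simplexCubic, pderiv_C_mul, map_sum]
  simp_rw [pderiv_C_mul, pderiv_linearForm]
  simp only [C_mul, map_sum]
  congr 1
  refine Finset.sum_congr rfl fun a _ => ?_
  ring

lemma polyHess_simplexCubic {n : ℕ} (v : Fin (n + 1) → Euc n) (x : Euc n) (i j : Fin n) :
    polyHess (simplexCubic v) x i j =
      (n : ℝ) ^ 2 / ((n : ℝ) + 1) * ∑ a, inner ℝ x (v a) * (v a i * v a j) := by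
  rw [polyHess, polyVal, pderiv_pderiv_simplexCubic, map_mul, eval_C, map_sum]
  simp_rw [map_mul (eval fun i => x i), eval_linearForm, eval_C, mul_comm (inner ℝ x _)]

lemma sum_polyVal_pderiv_simplexCubic {n : ℕ} (v : Fin (n + 1) → Euc n) (x w : Euc n) :
    ∑ i, polyVal (pderiv i (simplexCubic v)) x * w i =
      (n : ℝ) ^ 2 / (2 * ((n : ℝ) + 1)) * ∑ a, inner ℝ x (v a) ^ 2 * inner ℝ w (v a) := by
  simp_rw [polyVal, pderiv_simplexCubic, map_mul, eval_C, map_sum, map_mul, map_pow,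
    eval_linearForm, eval_C, mul_assoc]
  rw [← Finset.mul_sum]
  congr 1
  simp_rw [Finset.sum_mul]
  rw [Finset.sum_comm]
  refine Finset.sum_congr rfl fun a _ => ?_
  rw [PiLp.inner_apply w, Finset.mul_sum]
  refine Finset.sum_congr rfl fun i _ => ?_
  simp
  ring

lemma isHomogeneous_simplexCubic {n : ℕ} (v : Fin (n + 1) → Euc n) :
    (simplexCubic v).IsHomogeneous 3 := by
  refine IsHomogeneous.C_mul (IsHomogeneous.sum _ _ _ fun a _ => ?_) _
  have h : (∑ i, C (v a i) * X i : MvPolynomial (Fin n) ℝ).IsHomogeneous 1 :=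
    IsHomogeneous.sum _ _ _ fun i _ => IsHomogeneous.C_mul (isHomogeneous_X _ _) _
  simpa using h.pow 3

/-! ### The Einstein system and the nonassociativity tensor. -/

lemma polyLaplacian_simplexCubic {n : ℕ} {v : Fin (n + 1) → Euc n} (hv : IsRegularSimplex v) :
    polyLaplacian (simplexCubic v) = 0 := by
  simp_rw [polyLaplacian, pderiv_pderiv_simplexCubic]
  rw [← Finset.mul_sum, Finset.sum_comm]
  simp_rw [← Finset.sum_mul, ← map_sum, hv.sum_apply_mul, if_true, C_1, one_mul]
  rw [Finset.sum_comm]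
  simp_rw [← Finset.sum_mul, ← map_sum, hv.sum_apply]
  simp

lemma hessNormSq_simplexCubic {n : ℕ} (hn : n ≠ 0) {v : Fin (n + 1) → Euc n}
    (hv : IsRegularSimplex v) (x : Euc n) :
    hessNormSq (simplexCubic v) x = (n : ℝ) * ((n : ℝ) - 1) * ‖x‖ ^ 2 := by
  have hn' : (n : ℝ) ≠ 0 := by exact_mod_cast hn
  set t : Fin (n + 1) → ℝ := fun a => inner ℝ x (v a) with ht
  have key : ∑ i, ∑ j, (∑ a, t a * (v a i * v a j)) ^ 2 =
      ∑ a, ∑ b, t a * t b * (∑ i, v a i * v b i) ^ 2 := by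
    have h1 : ∀ i j, (∑ a, t a * (v a i * v a j)) ^ 2 =
        ∑ a, ∑ b, t a * t b * ((v a i * v b i) * (v a j * v b j)) := fun i j => by
      rw [sq, Finset.sum_mul_sum]
      exact Finset.sum_congr rfl fun a _ => Finset.sum_congr rfl fun b _ => by ring
    have h2 : ∀ a b, t a * t b * (∑ i, v a i * v b i) ^ 2 =
        ∑ i, ∑ j, t a * t b * ((v a i * v b i) * (v a j * v b j)) := fun a b => by
      rw [sq, Finset.sum_mul_sum]
      simp_rw [Finset.mul_sum]
    simp_rw [h1, h2]
    calc _ = ∑ i, ∑ a, ∑ j, ∑ b, t a * t b * ((v a i * v b i) * (v a j * v b j)) :=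
          Finset.sum_congr rfl fun i _ => Finset.sum_comm
      _ = ∑ a, ∑ i, ∑ j, ∑ b, t a * t b * ((v a i * v b i) * (v a j * v b j)) := Finset.sum_comm
      _ = ∑ a, ∑ i, ∑ b, ∑ j, t a * t b * ((v a i * v b i) * (v a j * v b j)) :=
          Finset.sum_congr rfl fun a _ => Finset.sum_congr rfl fun i _ => Finset.sum_comm
      _ = _ := Finset.sum_congr rfl fun a _ => Finset.sum_comm
  -- The squared Gram matrix is `(1 - 1/n²)` times the identity plus a constant matrix, whose
  -- contribution vanishes because `∑ t a = 0`.
  have h3 : ∀ a b, t a * t b * (if a = b then 1 else -1 / (n : ℝ)) ^ 2 =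
      (1 - 1 / (n : ℝ) ^ 2) * (if a = b then t a * t b else 0) + t a * t b * (1 / (n : ℝ) ^ 2) :=
    fun a b => by
      split_ifs
      · ring
      · field_simp
        ring
  simp_rw [hessNormSq, polyHess_simplexCubic, mul_pow, ← Finset.mul_sum]
  rw [key]
  simp_rw [hv.sum_apply_mul, h3, Finset.sum_add_distrib, ← Finset.mul_sum, ← Finset.sum_mul,
    ← Finset.mul_sum, ht, hv.sum_inner]
  simp only [Finset.sum_ite_eq, Finset.mem_univ, if_true, ← sq, hv.sum_inner_sq, mul_zero, zero_mul,
    Finset.sum_const_zero]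
  field_simp
  ring

/-- Contracting two third derivatives gives a quartic sum symmetric in all four indices and a
product of two metrics. The symmetric part cancels on antisymmetrizing in `i` and `j`. -/
lemma nonassocTensor_simplexCubic {n : ℕ} (hn : n ≠ 0) {v : Fin (n + 1) → Euc n}
    (hv : IsRegularSimplex v) (i j k l : Fin n) :
    nonassocTensor (simplexCubic v) i j k l =
      C (n : ℝ) * (euclMetric k i * euclMetric j l - euclMetric k j * euclMetric i l) := by
  have hn' : (n : ℝ) ≠ 0 := by exact_mod_cast hn
  have hE : ∀ i j : Fin n, euclMetric i j = C (if i = j then (1 : ℝ) else 0) := fun i j => by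
    rw [euclMetric]; split_ifs <;> simp
  have key : ∀ i j k l : Fin n,
      ∑ p, (∑ a, v a l * v a i * v a p) * (∑ b, v b j * v b k * v b p) =
      ((n : ℝ) + 1) / n * ∑ a, v a l * v a i * v a j * v a k -
        (((n : ℝ) + 1) / n) ^ 2 / n * ((if l = i then 1 else 0) * (if j = k then 1 else 0)) := by
    intro i j k l
    calc _ = ∑ b, ∑ a, (v a l * v a i) * (v b j * v b k) * ∑ p, v a p * v b p := by
          simp_rw [Finset.mul_sum, Finset.sum_mul]
          rw [Finset.sum_comm]
          refine Finset.sum_congr rfl fun b _ => ?_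
          rw [Finset.sum_comm]
          refine Finset.sum_congr rfl fun a _ => Finset.sum_congr rfl fun p _ => by ring
      _ = ∑ b, (((n : ℝ) + 1) / n * (v b l * v b i * (v b j * v b k)) -
            (∑ a, (v a l * v a i)) * (v b j * v b k) / n) := by
          refine Finset.sum_congr rfl fun b _ => ?_
          have h := hv.sum_mul_inner_eq hn (fun a => (v a l * v a i) * (v b j * v b k)) b
          simp_rw [hv.inner_eq] at h
          simp_rw [hv.sum_apply_mul]
          rw [h, Finset.sum_mul]
      _ = _ := by
          rw [Finset.sum_sub_distrib, ← Finset.mul_sum, ← Finset.sum_div, ← Finset.mul_sum,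
            hv.sum_apply_mul_apply, hv.sum_apply_mul_apply]
          simp only [mul_assoc]
          ring
  have hsum : ∀ i j k l : Fin n,
      ∑ p, polyThird (simplexCubic v) l i p * polyThird (simplexCubic v) j k p =
      C (((n : ℝ) ^ 2 / ((n : ℝ) + 1)) ^ 2 * (((n : ℝ) + 1) / n *
        ∑ a, v a l * v a i * v a j * v a k - (((n : ℝ) + 1) / n) ^ 2 / n *
          ((if l = i then 1 else 0) * (if j = k then 1 else 0)))) := fun i j k l => by
    rw [← key, Finset.mul_sum, map_sum]
    refine Finset.sum_congr rfl fun p _ => ?_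
    rw [polyThird_simplexCubic, polyThird_simplexCubic, ← C_mul]
    congr 1
    ring
  rw [nonassocTensor, Finset.sum_sub_distrib, hsum, hsum]
  simp only [hE, ← C_mul, ← C_sub]
  congr 1
  have hs : ∑ a, v a l * v a j * v a i * v a k = ∑ a, v a l * v a i * v a j * v a k :=
    Finset.sum_congr rfl fun a _ => by ring
  rw [hs]
  simp only [eq_comm (a := l) (b := i), eq_comm (a := l) (b := j), eq_comm (a := j) (b := k),
    eq_comm (a := i) (b := k)]
  field_simp
  ring

/-- A tensor of constant curvature type has pure trace: the Ricci trace is `c (1 - n)` times the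
metric, the scalar trace is `c n (1 - n)`, and the three coefficients add up to zero. -/
lemma confNonassocTensor_eq_zero {n : ℕ} (hn : 3 ≤ n) {P : MvPolynomial (Fin n) ℝ} {c : ℝ}
    (hP : ∀ i j k l : Fin n, nonassocTensor P i j k l =
      C c * (euclMetric k i * euclMetric j l - euclMetric k j * euclMetric i l))
    (i j k l : Fin n) : confNonassocTensor P i j k l = 0 := by
  have hE : ∀ i j : Fin n, euclMetric i j = C (if i = j then (1 : ℝ) else 0) := fun i j => by
    rw [euclMetric]; split_ifs <;> simp
  have hn' : (3 : ℝ) ≤ n := by exact_mod_cast hn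
  have h1 : (n : ℝ) - 1 ≠ 0 := by linarith
  have h2 : (n : ℝ) - 2 ≠ 0 := by linarith
  have hR : ∀ i j, nonassocRic P i j = C (c * (1 - n) * if i = j then 1 else 0) := fun i j => by
    simp only [nonassocRic, hP, hE, ← C_mul, ← C_sub, ← map_sum]
    congr 1
    rw [← Finset.mul_sum, Finset.sum_sub_distrib]
    simp only [mul_ite, mul_one, mul_zero, Finset.sum_ite_eq, Finset.mem_univ, if_true,
      Finset.sum_const, Finset.card_univ, Fintype.card_fin, nsmul_eq_mul,
      eq_comm (a := j) (b := i)]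
    split_ifs <;> simp
  have hS : nonassocScal P = C (c * (1 - n) * n) := by
    simp only [nonassocScal, hR, ← map_sum]
    simp
    ring
  simp only [confNonassocTensor, hP, hR, hS, hE, ← C_mul, ← C_sub, ← C_add]
  rw [← C_0]
  congr 1
  simp only [eq_comm (a := l) (b := i), eq_comm (a := l) (b := j), eq_comm (a := i) (b := k),
    eq_comm (a := j) (b := k)]
  field_simp
  ring

/-! ### Maxima on the unit sphere. -/

lemma polyVal_simplexCubic_smul {n : ℕ} (v : Fin (n + 1) → Euc n) (c : ℝ) (x : Euc n) :
    polyVal (simplexCubic v) (c • x) = c ^ 3 * polyVal (simplexCubic v) x := by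
  simp_rw [polyVal_simplexCubic, real_inner_smul_left, mul_pow, ← Finset.mul_sum]
  ring

namespace IsRegularSimplex

variable {n : ℕ} {v : Fin (n + 1) → Euc n}

/-- The cubic `(1 - t) (t + 1/n)^2` is nonnegative for `t ≤ 1` and vanishes just at `1` and `-1/n`,
the inner products between vertices. Its lower-order terms have known sums over the simplex, so the
identity yields both the bound and its equality case. -/
lemma polyVal_eq_sub (hv : IsRegularSimplex v) (hn : n ≠ 0) {x : Euc n} (hx : ‖x‖ = 1) :
    polyVal (simplexCubic v) x = ((n : ℝ) - 1) / 6 - (n : ℝ) ^ 2 / (6 * ((n : ℝ) + 1)) *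
      ∑ a, (1 - inner ℝ x (v a)) * (inner ℝ x (v a) + 1 / n) ^ 2 := by
  have hn' : (n : ℝ) ≠ 0 := by exact_mod_cast hn
  have h : ∀ t : ℝ, (1 - t) * (t + 1 / n) ^ 2 =
      1 / (n : ℝ) ^ 2 + (2 / (n : ℝ) - 1 / (n : ℝ) ^ 2) * t + (1 - 2 / n) * t ^ 2 - t ^ 3 :=
    fun t => by
      field_simp
      ring
  simp_rw [polyVal_simplexCubic, h, Finset.sum_sub_distrib, Finset.sum_add_distrib,
    ← Finset.mul_sum, hv.sum_inner, hv.sum_inner_sq, hx]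
  simp
  field_simp
  ring

lemma inner_le_one (hv : IsRegularSimplex v) {x : Euc n} (hx : ‖x‖ = 1) (a : Fin (n + 1)) :
    inner ℝ x (v a) ≤ 1 := by
  simpa [hx, hv.norm_eq_one] using real_inner_le_norm x (v a)

lemma polyVal_le (hv : IsRegularSimplex v) (hn : n ≠ 0) {x : Euc n} (hx : ‖x‖ = 1) :
    polyVal (simplexCubic v) x ≤ ((n : ℝ) - 1) / 6 := by
  rw [hv.polyVal_eq_sub hn hx]
  have : 0 ≤ ∑ a, (1 - inner ℝ x (v a)) * (inner ℝ x (v a) + 1 / n) ^ 2 :=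
    Finset.sum_nonneg fun a _ =>
      mul_nonneg (sub_nonneg.2 (hv.inner_le_one hx a)) (sq_nonneg _)
  exact sub_le_self _ (by positivity)

lemma polyVal_vertex (hv : IsRegularSimplex v) (hn : n ≠ 0) (b : Fin (n + 1)) :
    polyVal (simplexCubic v) (v b) = ((n : ℝ) - 1) / 6 := by
  rw [hv.polyVal_eq_sub hn (hv.norm_eq_one b), Finset.sum_eq_zero, mul_zero, sub_zero]
  intro a _
  rw [hv.inner_eq]
  split_ifs
  · simp
  · ring

lemma mem_range_of_polyVal_eq (hv : IsRegularSimplex v) (hn : n ≠ 0) {x : Euc n} (hx : ‖x‖ = 1)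
    (h : polyVal (simplexCubic v) x = ((n : ℝ) - 1) / 6) : x ∈ Set.range v := by
  have hn' : (0 : ℝ) < n := by positivity
  rw [hv.polyVal_eq_sub hn hx, sub_eq_self, mul_eq_zero, or_iff_right (by positivity),
    Finset.sum_eq_zero_iff_of_nonneg fun a _ =>
      mul_nonneg (sub_nonneg.2 (hv.inner_le_one hx a)) (sq_nonneg _)] at h
  by_contra hne
  have ht : ∀ a, inner ℝ x (v a) = -(1 / (n : ℝ)) := fun a => by
    rcases mul_eq_zero.1 (h a (Finset.mem_univ a)) with h1 | h1
    · exact absurd ⟨a, ((inner_eq_one_iff_of_norm_eq_one hx (hv.norm_eq_one a)).1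
        (sub_eq_zero.1 h1).symm).symm⟩ hne
    · exact eq_neg_of_add_eq_zero_left (pow_eq_zero_iff two_ne_zero |>.1 h1)
  -- If every inner product were `-1/n`, their sum would be `-(n+1)/n` instead of `0`.
  have h0 := hv.sum_inner x
  simp_rw [ht] at h0
  simp [hn] at h0
  exact absurd h0 (by positivity)

lemma sphereMaxima_eq (hv : IsRegularSimplex v) (hn : n ≠ 0) :
    sphereMaxima (simplexCubic v) = Set.range v := by
  ext x
  constructor
  · rintro ⟨hx, hmax⟩
    have hx' : ‖x‖ = 1 := by simpa using hx
    refine hv.mem_range_of_polyVal_eq hn hx' (le_antisymm (hv.polyVal_le hn hx') ?_)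
    rw [← hv.polyVal_vertex hn 0]
    exact hmax (by simp [hv.norm_eq_one])
  · rintro ⟨a, rfl⟩
    refine ⟨by simp [hv.norm_eq_one], fun y hy => ?_⟩
    change polyVal _ y ≤ polyVal _ (v a)
    rw [hv.polyVal_vertex hn]
    exact hv.polyVal_le hn (by simpa using hy)

lemma isGreatest_polyVal (hv : IsRegularSimplex v) (hn : n ≠ 0) :
    IsGreatest (polyVal (simplexCubic v) '' Metric.sphere (0 : Euc n) 1) (((n : ℝ) - 1) / 6) := by
  refine ⟨⟨v 0, by simp [hv.norm_eq_one], hv.polyVal_vertex hn 0⟩, ?_⟩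
  rintro _ ⟨x, hx, rfl⟩
  exact hv.polyVal_le hn (by simpa using hx)

lemma mInvariant_eq (hv : IsRegularSimplex v) (hn : 2 ≤ n) :
    mInvariant (simplexCubic v) = (n : ℝ) / ((n : ℝ) - 1) := by
  have hn0 : n ≠ 0 := by omega
  have hn' : (2 : ℝ) ≤ n := by exact_mod_cast hn
  have h1 : (n : ℝ) - 1 ≠ 0 := by linarith
  have h : ∀ e : sphereMaxima (simplexCubic v), hessNormSq (simplexCubic v) (e : Euc n) /
      (36 * polyVal (simplexCubic v) (e : Euc n) ^ 2) = (n : ℝ) / ((n : ℝ) - 1) := by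
    rintro ⟨e, he⟩
    rw [hv.sphereMaxima_eq hn0] at he
    obtain ⟨a, rfl⟩ := he
    rw [hessNormSq_simplexCubic hn0 hv, hv.polyVal_vertex hn0, hv.norm_eq_one]
    field_simp
    norm_num
  -- Nonemptiness matters: over an empty index type the real supremum would be `0`.
  have : Nonempty (sphereMaxima (simplexCubic v)) :=
    ⟨⟨v 0, by rw [hv.sphereMaxima_eq hn0]; exact ⟨0, rfl⟩⟩⟩
  simp_rw [mInvariant, h, ciSup_const]

lemma polyHess_vertex (hv : IsRegularSimplex v) (hn : n ≠ 0) (a : Fin (n + 1)) (i j : Fin n) :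
    polyHess (simplexCubic v) (v a) i j = (n : ℝ) * v a i * v a j - if i = j then 1 else 0 := by
  have hn' : (n : ℝ) ≠ 0 := by exact_mod_cast hn
  rw [polyHess_simplexCubic]
  simp_rw [mul_comm (inner ℝ (v a) _), hv.sum_mul_inner_eq' hn (fun b => v b i * v b j) a, hv.sum_apply_mul_apply]
  field_simp

/-! ### Critical points -/

/-- This is the Lagrange multiplier condition. Linear terms in `⟨w, v a⟩` pair to a multiple of `⟨w,
u⟩` and constants pair to zero, so being affine in `⟨w, v a⟩` is what makes the squares invisible to
tangent vectors. -/
lemma isSphereCritical_iff (hv : IsRegularSimplex v) (hn : n ≠ 0) {w : Euc n} :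
    IsSphereCritical (simplexCubic v) w ↔
      ‖w‖ = 1 ∧ ∃ A B : ℝ, ∀ a, inner ℝ w (v a) ^ 2 = A + B * inner ℝ w (v a) := by
  have hn' : (0 : ℝ) < n := by positivity
  have hc : (n : ℝ) ^ 2 / (2 * ((n : ℝ) + 1)) ≠ 0 := by positivity
  simp_rw [IsSphereCritical, sum_polyVal_pderiv_simplexCubic, mul_eq_zero, or_iff_right hc,
    mem_sphere_zero_iff_norm]
  refine and_congr_right fun hw => ⟨fun h => ?_, ?_⟩
  · set l := ∑ a, inner ℝ w (v a) ^ 2 * inner ℝ w (v a)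
    set S := ∑ a, inner ℝ w (v a) ^ 2
    refine ⟨(n : ℝ) / (n + 1) * (S / n), (n : ℝ) / (n + 1) * l, fun b => ?_⟩
    -- The test vector is the tangential part of `v b` at `w`.
    have h1 := h (v b - inner ℝ w (v b) • w) (by
      rw [inner_sub_right, inner_smul_right, real_inner_self_eq_norm_sq, hw]; ring)
    simp_rw [inner_sub_left, real_inner_smul_left, mul_sub, mul_left_comm _ (inner ℝ w (v b)),
      Finset.sum_sub_distrib, ← Finset.mul_sum] at h1
    rw [hv.sum_mul_inner_eq' hn (fun a => inner ℝ w (v a) ^ 2) b] at h1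
    change ((n : ℝ) + 1) / n * inner ℝ w (v b) ^ 2 - S / n - inner ℝ w (v b) * l = 0 at h1
    have h3 : inner ℝ w (v b) ^ 2 = (n : ℝ) / (n + 1) *
      (((n : ℝ) + 1) / n * inner ℝ w (v b) ^ 2) := by field_simp
    rw [h3]
    linear_combination (n : ℝ) / (n + 1) * h1
  · rintro ⟨A, B, h⟩ u hu
    simp_rw [h, add_mul, mul_assoc, Finset.sum_add_distrib, ← Finset.mul_sum, hv.sum_inner,
      hv.sum_inner_mul_inner, hu]
    ring

lemma inner_sum_vertex (hv : IsRegularSimplex v) (hn : n ≠ 0) (I : Finset (Fin (n + 1)))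
    (b : Fin (n + 1)) : inner ℝ (∑ a ∈ I, v a) (v b) =
      (((n : ℝ) + 1) / n) * (if b ∈ I then 1 else 0) - (I.card : ℝ) / n := by
  have h := hv.inner_sum_smul hn (fun a => if a ∈ I then 1 else 0) b
  simpa using h

lemma norm_sum_vertex_sq (hv : IsRegularSimplex v) (hn : n ≠ 0) (I : Finset (Fin (n + 1))) :
    ‖∑ a ∈ I, v a‖ ^ 2 = (I.card : ℝ) * ((n : ℝ) + 1 - I.card) / n := by
  rw [← real_inner_self_eq_norm_sq, inner_sum, Finset.sum_congr rfl fun b hb => by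
    rw [hv.inner_sum_vertex hn, if_pos hb]]
  simp
  ring

lemma isSphereCritical_vertexSum (hv : IsRegularSimplex v) (hn : n ≠ 0)
    {I : Finset (Fin (n + 1))} (h1 : 1 ≤ I.card) (h2 : I.card ≤ n) :
    IsSphereCritical (simplexCubic v)
      (Real.sqrt ((n : ℝ) / ((I.card : ℝ) * ((n : ℝ) + 1 - (I.card : ℝ)))) • ∑ a ∈ I, v a) := by
  have hn' : (0 : ℝ) < n := by positivity
  have h1' : (0 : ℝ) < I.card := by exact_mod_cast h1
  have h2' : (0 : ℝ) < (n : ℝ) + 1 - I.card := by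
    have : (I.card : ℝ) ≤ n := by exact_mod_cast h2
    linarith
  set r := Real.sqrt ((n : ℝ) / ((I.card : ℝ) * ((n : ℝ) + 1 - (I.card : ℝ))))
  have hr : r ^ 2 = (n : ℝ) / ((I.card : ℝ) * ((n : ℝ) + 1 - (I.card : ℝ))) :=
    Real.sq_sqrt (by positivity)
  rw [hv.isSphereCritical_iff hn]
  refine ⟨?_, ?_⟩
  · rw [← pow_eq_one_iff_of_nonneg (norm_nonneg _) two_ne_zero, norm_smul, mul_pow,
      hv.norm_sum_vertex_sq hn, Real.norm_eq_abs, sq_abs, hr]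
    field_simp
  -- `p` and `q` are the inner products with the vertices in `I` and outside `I`, the roots of `t² =
  -- (p + q) t - p q`.
  · set p := r * (((n : ℝ) + 1) / n - (I.card : ℝ) / n)
    set q := r * (-((I.card : ℝ) / n))
    refine ⟨-(p * q), p + q, fun a => ?_⟩
    rw [real_inner_smul_left, hv.inner_sum_vertex hn]
    split_ifs
    · simp only [p, q]; ring
    · simp only [p, q]; ring

lemma polyVal_vertexSum (hv : IsRegularSimplex v) (hn : n ≠ 0)
    {I : Finset (Fin (n + 1))} (h1 : 1 ≤ I.card) (h2 : I.card ≤ n) :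
    6 * polyVal (simplexCubic v)
      (Real.sqrt ((n : ℝ) / ((I.card : ℝ) * ((n : ℝ) + 1 - (I.card : ℝ)))) • ∑ a ∈ I, v a) =
      ((n : ℝ) + 1 - 2 * (I.card : ℝ)) *
        Real.sqrt ((n : ℝ) / ((I.card : ℝ) * ((n : ℝ) + 1 - (I.card : ℝ)))) := by
  have hn' : (0 : ℝ) < n := by positivity
  have h1' : (0 : ℝ) < I.card := by exact_mod_cast h1
  have h2' : (0 : ℝ) < (n : ℝ) + 1 - I.card := by
    have : (I.card : ℝ) ≤ n := by exact_mod_cast h2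
    linarith
  rw [polyVal_simplexCubic_smul]
  set r := Real.sqrt ((n : ℝ) / ((I.card : ℝ) * ((n : ℝ) + 1 - (I.card : ℝ))))
  have hr : r ^ 2 = (n : ℝ) / ((I.card : ℝ) * ((n : ℝ) + 1 - (I.card : ℝ))) :=
    Real.sq_sqrt (by positivity)
  have hs : ∑ a, inner ℝ (∑ a ∈ I, v a) (v a) ^ 3 =
      (I.card : ℝ) * (((n : ℝ) + 1) / n - (I.card : ℝ) / n) ^ 3 -
        ((n : ℝ) + 1 - I.card) * ((I.card : ℝ) / n) ^ 3 := by
    have h : ∀ a, inner ℝ (∑ a ∈ I, v a) (v a) ^ 3 = (if a ∈ I then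
        (((n : ℝ) + 1) / n - (I.card : ℝ) / n) ^ 3 + ((I.card : ℝ) / n) ^ 3 else 0) -
        ((I.card : ℝ) / n) ^ 3 := fun a => by
      rw [hv.inner_sum_vertex hn]
      split_ifs <;> ring
    simp_rw [h, Finset.sum_sub_distrib]
    rw [Finset.sum_ite_mem, Finset.univ_inter]
    simp only [Finset.sum_const, Finset.card_univ, Fintype.card_fin, nsmul_eq_mul]
    push_cast
    ring
  rw [polyVal_simplexCubic, hs, pow_succ, hr]
  field_simp
  ring

/-- The inner products with the vertices are roots of one quadratic and sum to zero without all
vanishing, so they take one positive and one negative value. `I` is the level set of the positive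
value, and the frame identity rebuilds `w` from it. -/
lemma exists_finset_of_isSphereCritical (hv : IsRegularSimplex v) (hn : n ≠ 0) {w : Euc n}
    (h : IsSphereCritical (simplexCubic v) w) :
    ∃ I : Finset (Fin (n + 1)), 1 ≤ I.card ∧ I.card ≤ n ∧
      w = Real.sqrt ((n : ℝ) / ((I.card : ℝ) * ((n : ℝ) + 1 - (I.card : ℝ)))) •
        ∑ a ∈ I, v a := by
  have hn' : (0 : ℝ) < n := by positivity
  obtain ⟨hw, A, B, h⟩ := (hv.isSphereCritical_iff hn).1 h
  have hne : ∃ a ∈ Finset.univ, inner ℝ w (v a) ≠ 0 := by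
    by_contra! h0
    have h1 := hv.sum_inner_sq w
    rw [Finset.sum_eq_zero (fun a ha => by rw [h0 a ha]; ring), hw] at h1
    exact absurd h1.symm (by positivity)
  obtain ⟨a, -, ha⟩ := Finset.exists_pos_of_sum_zero_of_exists_nonzero _ (hv.sum_inner w) hne
  obtain ⟨b, -, hb⟩ := Finset.exists_pos_of_sum_zero_of_exists_nonzero
    (fun a => -inner ℝ w (v a)) (by rw [Finset.sum_neg_distrib, hv.sum_inner, neg_zero])
    (by simpa using hne)
  set α := inner ℝ w (v a) with hα
  set I := Finset.univ.filter fun c => inner ℝ w (v c) = α with hI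
  have hval : ∀ c, c ∉ I → inner ℝ w (v c) = B - α := fun c hc => by
    have hc' : inner ℝ w (v c) - α ≠ 0 := sub_ne_zero.2 fun h => hc (by simp [hI, h])
    -- By Vieta, the other root of `t² = A + B t` is `B - α`.
    have h1 : (inner ℝ w (v c) - α) * (inner ℝ w (v c) - (B - α)) = 0 := by
      linear_combination h c - h a
    exact sub_eq_zero.1 ((mul_eq_zero.1 h1).resolve_left hc')
  have hbI : b ∉ I := fun hb' => by
    have : inner ℝ w (v b) = α := (Finset.mem_filter.1 hb').2
    simp only [this] at hb
    linarith
  have hβ : B - α < 0 := by rw [← hval b hbI]; linarith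
  have h1 : 1 ≤ I.card := Finset.card_pos.2 ⟨a, Finset.mem_filter.2 ⟨Finset.mem_univ a, hα.symm⟩⟩
  have h2 : I.card ≤ n := by
    have := Finset.card_lt_card (Finset.ssubset_univ_iff.2 fun h => hbI (h ▸ Finset.mem_univ b) :
      I ⊂ Finset.univ)
    simp at this
    omega
  refine ⟨I, h1, h2, ?_⟩
  have h1' : (0 : ℝ) < I.card := by exact_mod_cast h1
  have h2' : (0 : ℝ) < (n : ℝ) + 1 - I.card := by
    have : (I.card : ℝ) ≤ n := by exact_mod_cast h2
    linarith
  have hsum : ∑ c, inner ℝ w (v c) • v c = (α - (B - α)) • ∑ c ∈ I, v c := by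
    have hc : ∀ c, inner ℝ w (v c) • v c =
        (B - α) • v c + (α - (B - α)) • (if c ∈ I then v c else 0) := fun c => by
      by_cases hcI : c ∈ I
      · rw [if_pos hcI, ← add_smul, (Finset.mem_filter.1 hcI).2]
        congr 1
        ring
      · rw [if_neg hcI, hval c hcI, smul_zero, add_zero]
    simp_rw [hc, Finset.sum_add_distrib, ← Finset.smul_sum, hv.sum_eq_zero]
    rw [Finset.sum_ite_mem, Finset.univ_inter, smul_zero, zero_add]
  have hws : w = ((n : ℝ) / (n + 1) * (α - (B - α))) • ∑ c ∈ I, v c := by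
    rw [mul_smul, ← hsum, hv.sum_inner_smul, smul_smul]
    rw [show (n : ℝ) / (n + 1) * ((n + 1) / n) = 1 by field_simp, one_smul]
  have hs : 0 < (n : ℝ) / (n + 1) * (α - (B - α)) := mul_pos (by positivity) (by linarith)
  -- The scalar is positive, so the unit norm of `w` determines it as a square root.
  set s := (n : ℝ) / (n + 1) * (α - (B - α))
  have hs2 : s ^ 2 * ((I.card : ℝ) * ((n : ℝ) + 1 - I.card) / n) = 1 := by
    have h3 : ‖w‖ ^ 2 = 1 := by rw [hw, one_pow]
    rwa [hws, norm_smul, mul_pow, hv.norm_sum_vertex_sq hn, Real.norm_eq_abs, sq_abs] at h3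
  rw [show (n : ℝ) / ((I.card : ℝ) * ((n : ℝ) + 1 - (I.card : ℝ))) = s ^ 2 by
    rw [div_eq_iff (mul_pos h1' h2').ne']
    field_simp at hs2
    linarith, Real.sqrt_sq hs.le]
  exact hws

/-! ### Automorphisms -/

lemma linearEquiv_ext (hv : IsRegularSimplex v) (hn : n ≠ 0) {f g : Euc n ≃ₗ[ℝ] Euc n}
    (h : ∀ a, f (v a) = g (v a)) : f = g := by
  have hn' : (n : ℝ) ≠ 0 := by exact_mod_cast hn
  have h1 : ((n : ℝ) + 1) / n ≠ 0 := div_ne_zero (by positivity) hn'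
  refine LinearEquiv.ext fun x => ?_
  have h2 : f ((((n : ℝ) + 1) / n) • x) = g ((((n : ℝ) + 1) / n) • x) := by
    rw [← hv.sum_inner_smul, map_sum, map_sum]
    simp_rw [map_smul, h]
  rw [map_smul, map_smul] at h2
  exact smul_right_injective _ h1 h2

/-- If `g` scales norms by `c`, the unit vector `c⁻¹ • g (v 0)` has value `c⁻³` times the maximum,
which is positive as `2 ≤ n`; hence `1 ≤ c`. The same bound for `g⁻¹` gives `c = 1`. -/
lemma norm_map_of_mem_polyAut (hv : IsRegularSimplex v) (hn : 2 ≤ n) {g : Euc n ≃ₗ[ℝ] Euc n}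
    (hg : g ∈ polyAut (simplexCubic v)) (x : Euc n) : ‖g x‖ = ‖x‖ := by
  have hn0 : n ≠ 0 := by omega
  have hn' : (2 : ℝ) ≤ n := by exact_mod_cast hn
  have key : ∀ {g : Euc n ≃ₗ[ℝ] Euc n} {c : ℝ}, 0 < c → (∀ x, ‖g x‖ = c * ‖x‖) →
      (∀ x, polyVal (simplexCubic v) (g x) = polyVal (simplexCubic v) x) → 1 ≤ c := by
    intro g c hc hg hP
    have h1 := hv.polyVal_le hn0 (x := c⁻¹ • g (v 0)) (by
      rw [norm_smul, hg, hv.norm_eq_one, mul_one, Real.norm_eq_abs, abs_inv, abs_of_pos hc,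
        inv_mul_cancel₀ hc.ne'])
    rw [polyVal_simplexCubic_smul, hP, hv.polyVal_vertex hn0,
      mul_le_iff_le_one_left (by linarith)] at h1
    have h2 : c⁻¹ ≤ 1 := (pow_le_one_iff_of_nonneg (inv_pos.2 hc).le three_ne_zero).1 h1
    exact (inv_le_one₀ hc).1 h2
  obtain ⟨⟨c, hc, hgc⟩, hP⟩ := hg
  have hinv : ∀ x, g (g⁻¹ x) = x := fun x => g.apply_symm_apply x
  have h1 := key hc hgc hP
  have h2 : 1 ≤ c⁻¹ := key (g := g⁻¹) (inv_pos.2 hc) (fun x => by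
    have h := hgc (g⁻¹ x)
    rw [hinv] at h
    rw [h, inv_mul_cancel_left₀ hc.ne']) (fun x => by rw [← hP (g⁻¹ x), hinv])
  have h3 : c = 1 := le_antisymm ((one_le_inv₀ hc).1 h2) h1
  rw [hgc, h3, one_mul]

lemma map_vertex_mem_range (hv : IsRegularSimplex v) (hn : 2 ≤ n) {g : Euc n ≃ₗ[ℝ] Euc n}
    (hg : g ∈ polyAut (simplexCubic v)) (a : Fin (n + 1)) : ∃ b, g (v a) = v b := by
  have hn0 : n ≠ 0 := by omega
  obtain ⟨b, hb⟩ := hv.mem_range_of_polyVal_eq hn0 (x := g (v a))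
    (by rw [hv.norm_map_of_mem_polyAut hn hg, hv.norm_eq_one])
    (by rw [hg.2, hv.polyVal_vertex hn0])
  exact ⟨b, hb.symm⟩

lemma exists_monoidHom_perm (hv : IsRegularSimplex v) (hn : 2 ≤ n) :
    ∃ Φ : polyAut (simplexCubic v) →* Equiv.Perm (Fin (n + 1)),
      ∀ (g : polyAut (simplexCubic v)) a, (g : Euc n ≃ₗ[ℝ] Euc n) (v a) = v (Φ g a) := by
  choose f hf using fun (g : polyAut (simplexCubic v)) a => hv.map_vertex_mem_range hn g.2 a
  -- A monoid homomorphism from a group to self-maps takes values in bijections, so only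
  -- multiplicativity has to be checked.
  refine ⟨MonoidHom.toHomPerm
    { toFun := fun g => (f g : Function.End (Fin (n + 1)))
      map_one' := ?_
      map_mul' := ?_ }, fun g a => hf g a⟩
  · funext a
    apply hv.injective
    rw [← hf]
    rfl
  · intro g h
    funext a
    apply hv.injective
    change v (f (g * h) a) = v (f g (f h a))
    rw [← hf, ← hf, ← hf]
    rfl

lemma mem_polyAut_of_perm {g : Euc n ≃ₗ[ℝ] Euc n}
    (hg : ∀ x, ‖g x‖ = ‖x‖) (σ : Equiv.Perm (Fin (n + 1))) (hσ : ∀ a, g (v a) = v (σ a)) :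
    g ∈ polyAut (simplexCubic v) := by
  refine ⟨⟨1, one_pos, fun x => by rw [hg, one_mul]⟩, fun x => ?_⟩
  let e : Euc n →ₗᵢ[ℝ] Euc n := ⟨g.toLinearMap, hg⟩
  have he : ∀ x y, inner ℝ (g x) (g y) = inner ℝ x y := fun x y => e.inner_map_map x y
  rw [polyVal_simplexCubic, polyVal_simplexCubic, ← Equiv.sum_comp σ]
  simp_rw [← hσ, he]

/-- Vectors of equal norm are exchanged by the reflection in their difference, and every other
vertex has equal inner products with both, so it lies on the mirror. -/
lemma hyperplaneReflection_vertex (hv : IsRegularSimplex v) (a b c : Fin (n + 1)) :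
    hyperplaneReflection (v a - v b) (v c) = v (Equiv.swap a b c) := by
  have hab : Submodule.reflection (ℝ ∙ (v a - v b))ᗮ (v a) = v b :=
    Submodule.reflection_sub (by rw [hv.norm_eq_one, hv.norm_eq_one])
  change Submodule.reflection (ℝ ∙ (v a - v b))ᗮ (v c) = _
  rcases eq_or_ne c a with rfl | hca
  · rw [hab, Equiv.swap_apply_left]
  rcases eq_or_ne c b with rfl | hcb
  · have h := Submodule.reflection_reflection (ℝ ∙ (v a - v c))ᗮ (v a)
    rw [hab] at h
    rw [Equiv.swap_apply_right, h]
  · rw [Equiv.swap_apply_of_ne_of_ne hca hcb]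
    refine Submodule.reflection_mem_subspace_eq_self ?_
    rw [Submodule.mem_orthogonal_singleton_iff_inner_left, inner_sub_right, hv.inner_eq,
      hv.inner_eq, if_neg hca, if_neg hcb, sub_self]

lemma hyperplaneReflection_mem_polyAut (hv : IsRegularSimplex v) (a b : Fin (n + 1)) :
    hyperplaneReflection (v a - v b) ∈ polyAut (simplexCubic v) :=
  mem_polyAut_of_perm (fun x => LinearIsometryEquiv.norm_map _ x) (Equiv.swap a b)
    (hv.hyperplaneReflection_vertex a b)

/-- Transpositions generate the symmetric group. This serves twice: for the surjectivity of the
action and for the generation of `polyAut` by reflections. -/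
lemma exists_mem_closure_reflections (hv : IsRegularSimplex v) (σ : Equiv.Perm (Fin (n + 1))) :
    ∃ g ∈ Subgroup.closure {g | ∃ y ∈ Set.range v, ∃ z ∈ Set.range v,
      y ≠ z ∧ g = hyperplaneReflection (y - z)}, ∀ a, g (v a) = v (σ a) := by
  have hσ : σ ∈ Subgroup.closure {σ : Equiv.Perm (Fin (n + 1)) | σ.IsSwap} := by
    rw [Equiv.Perm.closure_isSwap]
    trivial
  induction hσ using Subgroup.closure_induction with
  | mem σ h =>
    obtain ⟨a, b, hab, rfl⟩ := h
    exact ⟨_, Subgroup.subset_closure ⟨v a, ⟨a, rfl⟩, v b, ⟨b, rfl⟩, hv.injective.ne hab, rfl⟩,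
      hv.hyperplaneReflection_vertex a b⟩
  | one => exact ⟨1, one_mem _, fun a => rfl⟩
  | mul σ τ _ _ hσ hτ =>
    obtain ⟨g, hg, hgσ⟩ := hσ
    obtain ⟨h, hh, hhτ⟩ := hτ
    exact ⟨g * h, mul_mem hg hh, fun a => by
      rw [LinearEquiv.mul_apply, hhτ, hgσ, Equiv.Perm.mul_apply]⟩
  | inv σ _ hσ =>
    obtain ⟨g, hg, hgσ⟩ := hσ
    refine ⟨g⁻¹, inv_mem hg, fun a => ?_⟩
    have h := hgσ (σ⁻¹ a)
    rw [← Equiv.Perm.mul_apply, mul_inv_cancel, Equiv.Perm.one_apply] at h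
    rw [← h]
    exact g.symm_apply_apply _

lemma closure_reflections_le (hv : IsRegularSimplex v) :
    Subgroup.closure {g | ∃ y ∈ Set.range v, ∃ z ∈ Set.range v,
      y ≠ z ∧ g = hyperplaneReflection (y - z)} ≤ polyAut (simplexCubic v) := by
  rw [Subgroup.closure_le]
  rintro _ ⟨_, ⟨a, rfl⟩, _, ⟨b, rfl⟩, -, rfl⟩
  exact hv.hyperplaneReflection_mem_polyAut a b

lemma polyAut_eq_closure (hv : IsRegularSimplex v) (hn : 2 ≤ n) :
    polyAut (simplexCubic v) = Subgroup.closure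
      {g | ∃ y ∈ Set.range v, ∃ z ∈ Set.range v, y ≠ z ∧ g = hyperplaneReflection (y - z)} := by
  refine le_antisymm (fun g hg => ?_) hv.closure_reflections_le
  obtain ⟨Φ, hΦ⟩ := hv.exists_monoidHom_perm hn
  obtain ⟨h, hh, hhσ⟩ := hv.exists_mem_closure_reflections (Φ ⟨g, hg⟩)
  have hgh : g = h := hv.linearEquiv_ext (by omega) fun a => (hΦ ⟨g, hg⟩ a).trans (hhσ a).symm
  rwa [hgh]

lemma exists_mulEquiv_perm (hv : IsRegularSimplex v) (hn : 2 ≤ n) :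
    ∃ Φ : polyAut (simplexCubic v) ≃* Equiv.Perm (Fin (n + 1)),
      ∀ (g : polyAut (simplexCubic v)) a, (g : Euc n ≃ₗ[ℝ] Euc n) (v a) = v (Φ g a) := by
  obtain ⟨Φ, hΦ⟩ := hv.exists_monoidHom_perm hn
  refine ⟨MulEquiv.ofBijective Φ ⟨fun g h hgh => ?_, fun σ => ?_⟩, hΦ⟩
  · exact Subtype.ext (hv.linearEquiv_ext (by omega) fun a => by rw [hΦ, hΦ, hgh])
  · obtain ⟨g, hg, hgσ⟩ := hv.exists_mem_closure_reflections σ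
    refine ⟨⟨g, hv.closure_reflections_le hg⟩, Equiv.ext fun a => hv.injective ?_⟩
    rw [← hΦ, ← hgσ]

/-! ### Indecomposability -/

/-- No two vertices are orthogonal, so all of them lie in `A`; as they form a frame, nothing nonzero
is orthogonal to them all. -/
lemma eq_bot_of_vertex_mem (hv : IsRegularSimplex v) (hn : n ≠ 0) {A B : Submodule ℝ (Euc n)}
    (hAB : A ⟂ B) (h : ∀ a, v a ∈ A ∨ v a ∈ B) (h0 : v 0 ∈ A) : B = ⊥ := by
  have hn' : (n : ℝ) ≠ 0 := by exact_mod_cast hn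
  have hA : ∀ a, v a ∈ A := fun a => (h a).resolve_right fun hB => by
    have h1 : inner ℝ (v 0) (v a) = 0 := Submodule.isOrtho_iff_inner_eq.1 hAB _ h0 _ hB
    rw [hv.inner_eq] at h1
    split_ifs at h1
    · exact one_ne_zero h1
    · exact div_ne_zero (by norm_num) hn' h1
  rw [Submodule.eq_bot_iff]
  intro y hy
  have h1 := hv.sum_inner_sq y
  rw [Finset.sum_eq_zero fun a _ => by
    rw [Submodule.isOrtho_iff_inner_eq.1 hAB.symm y hy _ (hA a)]; ring] at h1
  have h2 : ((n : ℝ) + 1) / n ≠ 0 := div_ne_zero (by positivity) hn'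
  exact norm_eq_zero.1 (pow_eq_zero_iff two_ne_zero |>.1
    ((mul_eq_zero.1 h1.symm).resolve_left h2))

/-- A splitting makes the polarized cubic vanish on `A × B × ℝⁿ`. Evaluated at the vertices, this
makes one component of each vertex vanish. -/
lemma not_orthDecomposable (hv : IsRegularSimplex v) (hn : n ≠ 0) :
    ¬ OrthDecomposable (simplexCubic v) := by
  rintro ⟨A, B, hA, hB, hAB, hcompl, hP⟩
  have hn' : (0 : ℝ) < n := by positivity
  have hc : (n : ℝ) ^ 2 / (6 * ((n : ℝ) + 1)) ≠ 0 := by positivity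
  have hn1 : ((n : ℝ) + 1) / n ≠ 0 := by positivity
  have hmix : ∀ x ∈ A, ∀ y ∈ B, ∑ a, inner ℝ x (v a) ^ 2 * inner ℝ y (v a) +
      ∑ a, inner ℝ x (v a) * inner ℝ y (v a) ^ 2 = 0 := fun x hx y hy => by
    have h := hP x hx y hy
    have hcube : ∀ s t : ℝ, (s + t) ^ 3 = s ^ 3 + 3 * (s ^ 2 * t) + 3 * (s * t ^ 2) + t ^ 3 :=
      fun s t => by ring
    simp_rw [polyVal_simplexCubic, ← mul_add, mul_right_inj' hc, inner_add_left, hcube,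
      Finset.sum_add_distrib, ← Finset.mul_sum] at h
    linear_combination h / 3
  have hxxy : ∀ x ∈ A, ∀ y ∈ B, ∑ a, inner ℝ x (v a) ^ 2 * inner ℝ y (v a) = 0 ∧
      ∑ a, inner ℝ x (v a) * inner ℝ y (v a) ^ 2 = 0 := fun x hx y hy => by
    have h1 := hmix x hx y hy
    -- Changing the sign of `y` separates the terms odd and even in `y`.
    have h2 := hmix x hx (-y) (neg_mem hy)
    simp_rw [inner_neg_left, neg_sq, mul_neg, Finset.sum_neg_distrib] at h2
    constructor <;> linarith
  have hxzy : ∀ x ∈ A, ∀ y ∈ B, ∀ z,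
      ∑ a, inner ℝ x (v a) * inner ℝ y (v a) * inner ℝ z (v a) = 0 := fun x hx y hy z => by
    obtain ⟨p, hp, q, hq, rfl⟩ := Submodule.mem_sup.1
      (hcompl.sup_eq_top ▸ Submodule.mem_top : z ∈ A ⊔ B)
    -- Polarization in the first argument treats the component of `z` in `A`, and polarization in
    -- the second its component in `B`.
    have h1 := (hxxy (x + p) (add_mem hx hp) y hy).1
    have h2 := (hxxy x hx (y + q) (add_mem hy hq)).2
    simp_rw [inner_add_left, add_sq, add_mul, Finset.sum_add_distrib] at h1
    simp_rw [inner_add_left, add_sq, mul_add, Finset.sum_add_distrib] at h2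
    rw [(hxxy x hx y hy).1, (hxxy p hp y hy).1] at h1
    rw [(hxxy x hx y hy).2, (hxxy x hx q hq).2] at h2
    have e1 : ∑ a, 2 * inner ℝ x (v a) * inner ℝ p (v a) * inner ℝ y (v a) =
        2 * ∑ a, inner ℝ x (v a) * inner ℝ y (v a) * inner ℝ p (v a) := by
      rw [Finset.mul_sum]
      exact Finset.sum_congr rfl fun a _ => by ring
    have e2 : ∑ a, inner ℝ x (v a) * (2 * inner ℝ y (v a) * inner ℝ q (v a)) =
        2 * ∑ a, inner ℝ x (v a) * inner ℝ y (v a) * inner ℝ q (v a) := by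
      rw [Finset.mul_sum]
      exact Finset.sum_congr rfl fun a _ => by ring
    rw [e1] at h1
    rw [e2] at h2
    simp_rw [inner_add_left, mul_add, Finset.sum_add_distrib]
    linarith
  have hxy : ∀ x ∈ A, ∀ y ∈ B, ∀ b, inner ℝ x (v b) * inner ℝ y (v b) = 0 :=
    fun x hx y hy b => by
      -- The weights `⟨x, v a⟩ ⟨y, v a⟩` have zero sum and pair to zero with each vertex, so each
      -- weight is zero.
      have h1 := hv.sum_mul_inner_eq' hn (fun a => inner ℝ x (v a) * inner ℝ y (v a)) b
      rw [hxzy x hx y hy, hv.sum_inner_mul_inner, Submodule.isOrtho_iff_inner_eq.1 hAB x hx y hy,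
        mul_zero, zero_div, sub_zero] at h1
      exact (mul_eq_zero.1 h1.symm).resolve_left hn1
  have hmem : ∀ a, v a ∈ A ∨ v a ∈ B := fun a => by
    obtain ⟨p, hp, q, hq, hpq⟩ := Submodule.mem_sup.1
      (hcompl.sup_eq_top ▸ Submodule.mem_top : v a ∈ A ⊔ B)
    have h := hxy p hp q hq a
    have hpq0 := Submodule.isOrtho_iff_inner_eq.1 hAB p hp q hq
    -- With `v a = p + q` and `p ⟂ q`, the vanishing product is `‖p‖² ‖q‖²`.
    rw [← hpq, inner_add_right, inner_add_right, hpq0, real_inner_comm p q, hpq0, add_zero, zero_add,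
      mul_eq_zero, inner_self_eq_zero, inner_self_eq_zero] at h
    rcases h with rfl | rfl
    · right
      rwa [← hpq, zero_add]
    · left
      rwa [← hpq, add_zero]
  rcases hmem 0 with h0 | h0
  · exact hB (hv.eq_bot_of_vertex_mem hn hAB hmem h0)
  · exact hA (hv.eq_bot_of_vertex_mem hn hAB.symm (fun a => (hmem a).symm) h0)

end IsRegularSimplex

/-! ### The theorem for the Helmert simplex. -/

theorem mainTheorem4 (n : ℕ) (hn : 2 ≤ n) :
    (simplicialPoly n).IsHomogeneous 3 ∧
    SolvesEinstein (simplicialPoly n) ((n : ℝ) * ((n : ℝ) - 1)) ∧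
    IsConfAssocSolution (simplicialPoly n) ((n : ℝ) * ((n : ℝ) - 1)) ∧
    (3 ≤ n → ∀ i j k l : Fin n, confNonassocTensor (simplicialPoly n) i j k l = 0) ∧
    mInvariant (simplicialPoly n) = (n : ℝ) / ((n : ℝ) - 1) ∧
    IsGreatest (polyVal (simplicialPoly n) '' Metric.sphere (0 : Euc n) 1) (((n : ℝ) - 1) / 6) ∧
    (sphereMaxima (simplicialPoly n)).ncard = n + 1 ∧
    polyAut (simplicialPoly n) = Subgroup.closure
      {g | ∃ y ∈ sphereMaxima (simplicialPoly n), ∃ z ∈ sphereMaxima (simplicialPoly n),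
        y ≠ z ∧ g = hyperplaneReflection (y - z)} ∧
    ¬ OrthDecomposable (simplicialPoly n) ∧
    ∃ v : Fin (n + 1) → Euc n,
      Function.Injective v ∧
      Set.range v = sphereMaxima (simplicialPoly n) ∧
      ∑ a, v a = 0 ∧
      (∀ a b, a ≠ b → inner ℝ (v a) (v b) = -1 / (n : ℝ)) ∧
      (∀ x : Euc n, ∑ a, inner ℝ x (v a) • v a = (((n : ℝ) + 1) / (n : ℝ)) • x) ∧
      (∀ a, ∀ i j : Fin n, polyHess (simplicialPoly n) (v a) i j =
        (n : ℝ) * v a i * v a j - if i = j then 1 else 0) ∧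
      (∃ Φ : polyAut (simplicialPoly n) ≃* Equiv.Perm (Fin (n + 1)),
        ∀ (g : polyAut (simplicialPoly n)) a, (g : Euc n ≃ₗ[ℝ] Euc n) (v a) = v (Φ g a)) ∧
      (∀ w : Euc n, IsSphereCritical (simplicialPoly n) w ↔
        ∃ I : Finset (Fin (n + 1)), 1 ≤ I.card ∧ I.card ≤ n ∧
          w = Real.sqrt ((n : ℝ) / ((I.card : ℝ) * ((n : ℝ) + 1 - (I.card : ℝ)))) •
            ∑ a ∈ I, v a) ∧
      (∀ I : Finset (Fin (n + 1)), 1 ≤ I.card → I.card ≤ n →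
        6 * polyVal (simplicialPoly n)
            (Real.sqrt ((n : ℝ) / ((I.card : ℝ) * ((n : ℝ) + 1 - (I.card : ℝ)))) •
              ∑ a ∈ I, v a) =
          ((n : ℝ) + 1 - 2 * (I.card : ℝ)) *
            Real.sqrt ((n : ℝ) / ((I.card : ℝ) * ((n : ℝ) + 1 - (I.card : ℝ))))) := by
  have hn0 : n ≠ 0 := by omega
  have hn1 : (n : ℝ) - 1 ≠ 0 := by
    have : (2 : ℝ) ≤ n := by exact_mod_cast hn
    linarith
  have hv := isRegularSimplex_simplexVertex hn0
  have hna := nonassocTensor_simplexCubic hn0 hv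
  rw [simplicialPoly_eq_simplexCubic hn0]
  have hE : SolvesEinstein (simplexCubic (simplexVertex n)) ((n : ℝ) * ((n : ℝ) - 1)) :=
    ⟨polyLaplacian_simplexCubic hv, hessNormSq_simplexCubic hn0 hv⟩
  have hmax := hv.sphereMaxima_eq hn0
  refine ⟨isHomogeneous_simplexCubic _, hE, ⟨hE, fun i j k l => ?_⟩,
    fun h3 => confNonassocTensor_eq_zero h3 hna, hv.mInvariant_eq hn, hv.isGreatest_polyVal hn0,
    ?_, ?_, hv.not_orthDecomposable hn0, simplexVertex n, hv.injective, hmax.symm, hv.sum_eq_zero,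
    fun a b hab => ?_, hv.sum_inner_smul, hv.polyHess_vertex hn0, hv.exists_mulEquiv_perm hn,
    fun w => ⟨hv.exists_finset_of_isSphereCritical hn0, ?_⟩,
    fun I h1 h2 => hv.polyVal_vertexSum hn0 h1 h2⟩
  · rw [hna, mul_div_cancel_right₀ _ hn1]
  · rw [hmax, ← Set.image_univ, Set.ncard_image_of_injective _ hv.injective, Set.ncard_univ,
      Nat.card_fin]
  · rw [hmax]
    exact hv.polyAut_eq_closure hn
  · rw [hv.inner_eq, if_neg hab]
  · rintro ⟨I, h1, h2, rfl⟩
    exact hv.isSphereCritical_vertexSum hn0 h1 h2
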